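/- Let $\tau:[0,1]\to[0,1]$ be the symmetric tent map, $\tau(x)=2x$ for $0\le x<1/2$ and $\tau(x)=2-2x$ for $1/2\le x\le 1$. For $0<\alpha<1$ let $G_\alpha$ be the map of the square $[0,1]^2$ into itself given by $$G_\alpha(x,y)=\bigl(y,\ \tau(\alpha y+(1-\alpha)x)\bigr).$$ **Theorem 6.** Let $1/2<\alpha<3/4$. The set of points of $[0,1]^2$ whose $G_\alpha$-orbit converges to the point $X_0=(2/3,2/3)$ is exactly $[0,1]^2\setminus\{(0,0)\}$. Moreover, $X_0$ is an almost global attractor of $G_\alpha$ on $[0,1]^2$: it is an attracting fixed point (fixed, Lyapunov stable, and attracting all points near it), and it attracts Lebesgue-almost every point of the square. -/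

import Mathlib

open Set Filter Topology MeasureTheory

/-- The symmetric tent map, used on `[0, 1]`. -/
noncomputable def tent (x : ℝ) : ℝ :=
  if x < 1 / 2 then 2 * x else 2 - 2 * x

/-- The planar map `G_α (x, y) = (y, τ (α y + (1 - α) x))` of the memory process with base
map `τ`; the pair is (memory state, present state). -/
noncomputable def memoryMap (τ : ℝ → ℝ) (α : ℝ) (p : ℝ × ℝ) : ℝ × ℝ :=
  (p.2, τ (α * p.2 + (1 - α) * p.1))

/-- The unit square `[0, 1] × [0, 1]`, the phase space. -/
def unitSquare : Set (ℝ × ℝ) := Icc 0 1 ×ˢ Icc 0 1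

/-- The points of `U` whose `F`-orbit converges to `c` (the points attracted to `c`). -/
def basin {X : Type*} [TopologicalSpace X] (F : X → X) (U : Set X) (c : X) : Set X :=
  {p | p ∈ U ∧ Tendsto (fun n : ℕ => F^[n] p) atTop (𝓝 c)}

/-- `c` is a Lyapunov stable point of the dynamical system `F` on `U`. -/
def IsLyapunovStable {X : Type*} [TopologicalSpace X] (F : X → X) (U : Set X) (c : X) : Prop :=
  ∀ V ∈ 𝓝 c, ∃ W ∈ 𝓝 c, ∀ p ∈ W ∩ U, ∀ n : ℕ, F^[n] p ∈ V

/-- `c` is an attracting fixed point (asymptotically stable) of the dynamical system `F` on `U`: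
it is fixed, Lyapunov stable, and attracts all points of `U` near it. -/
structure IsAttractingFixedPoint {X : Type*} [TopologicalSpace X]
    (F : X → X) (U : Set X) (c : X) : Prop where
  mem : c ∈ U
  isFixedPt : Function.IsFixedPt F c
  stable : IsLyapunovStable F U c
  attracts_nearby : ∃ W ∈ 𝓝 c, W ∩ U ⊆ basin F U c

/-- `c` is an almost global attractor of the dynamical system `F` on `U`: an attracting fixed
point that attracts almost every point of `U`. -/
structure IsAlmostGlobalAttractor {X : Type*} [TopologicalSpace X] [MeasureSpace X]
    (F : X → X) (U : Set X) (c : X) : Prop extends IsAttractingFixedPoint F U c where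
  ae_attracts : volume (U \ basin F U c) = 0

/-! The quadratic form `tentEnergy` is a Lyapunov function centred at the fixed point. One step on
the right branch lowers it by `3 * (crossCoeff α - 1) * (y - 2/3)^2`; on the left branch it drops
strictly away from the origin (`tentEnergy_memoryMap_le`). Constant energy over two steps forces the
fixed point, so LaSalle's principle applies on compact sublevel sets. These avoid the origin, the
strict energy maximum on the square (`tentEnergy_lt_zero_zero`). -/

theorem tent_eq_min (x : ℝ) : tent x = min (2 * x) (2 - 2 * x) := by
  unfold tent
  split_ifs with h
  · rw [min_eq_left (by linarith)]
  · rw [min_eq_right (by linarith)]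

theorem continuous_memoryMap_tent (α : ℝ) : Continuous (memoryMap tent α) := by
  have h : memoryMap tent α = fun p : ℝ × ℝ =>
      (p.2, min (2 * (α * p.2 + (1 - α) * p.1)) (2 - 2 * (α * p.2 + (1 - α) * p.1))) := by
    funext p
    simp [memoryMap, tent_eq_min]
  rw [h]
  fun_prop

theorem mapsTo_memoryMap_tent {α : ℝ} (h0 : 0 ≤ α) (h1 : α ≤ 1) :
    MapsTo (memoryMap tent α) unitSquare unitSquare := by
  rintro ⟨x, y⟩ ⟨⟨hx0, hx1⟩, ⟨hy0, hy1⟩⟩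
  refine ⟨⟨hy0, hy1⟩, ?_⟩
  simp only [memoryMap] at *
  have hz0 : 0 ≤ α * y + (1 - α) * x := by
    have := mul_nonneg h0 hy0
    have := mul_nonneg (sub_nonneg.2 h1) hx0
    linarith
  have hz1 : α * y + (1 - α) * x ≤ 1 := by
    have := mul_le_mul_of_nonneg_left hy1 h0
    have := mul_le_mul_of_nonneg_left hx1 (sub_nonneg.2 h1)
    linarith
  unfold tent
  split_ifs with h <;> constructor <;> linarith

theorem isCompact_unitSquare : IsCompact unitSquare :=
  isCompact_Icc.prod isCompact_Icc

theorem MapClusterPt.eq_of_tendsto {X ι : Type*} [TopologicalSpace X] [T2Space X] {l : Filter ι}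
    {u : ι → X} {x y : X} (hx : MapClusterPt x l u) (hy : Tendsto u l (𝓝 y)) : x = y := by
  have : NeBot (𝓝 x ⊓ 𝓝 y) := NeBot.mono hx (inf_le_inf_left _ hy)
  exact eq_of_nhds_neBot this

/-- LaSalle's principle on a compact forward invariant set: if a continuous function does not
increase along orbits, and two steps preserve its value only at `c`, all orbits converge to `c`. -/
theorem tendsto_iterate_of_lyapunov {X : Type*} [TopologicalSpace X] {F : X → X} {K : Set X}
    {V : X → ℝ} {c : X} (hK : IsCompact K) (hF : Continuous F) (hV : Continuous V)
    (hFK : MapsTo F K K) (hle : ∀ p ∈ K, V (F p) ≤ V p)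
    (heq : ∀ p ∈ K, V (F (F p)) = V p → p = c) {p : X} (hp : p ∈ K) :
    Tendsto (fun n : ℕ => F^[n] p) atTop (𝓝 c) := by
  have hmem : ∀ n : ℕ, F^[n] p ∈ K := fun n => hFK.iterate n hp
  have hanti : Antitone fun n : ℕ => V (F^[n] p) := by
    refine antitone_nat_of_succ_le fun n => ?_
    rw [Function.iterate_succ_apply']
    exact hle _ (hmem n)
  have hbdd : BddBelow (range fun n : ℕ => V (F^[n] p)) := by
    refine (hK.image hV).bddBelow.mono ?_
    rintro _ ⟨n, rfl⟩
    exact mem_image_of_mem V (hmem n)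
  have hlim := tendsto_atTop_ciInf hanti hbdd
  refine hK.tendsto_nhds_of_unique_mapClusterPt (Eventually.of_forall hmem) ?_
  intro q hq hcl
  have h1 : MapClusterPt (V q) atTop fun n : ℕ => V (F^[n] p) :=
    hcl.continuousAt_comp hV.continuousAt
  have h2 : MapClusterPt (V (F (F q))) atTop fun n : ℕ => V (F (F (F^[n] p))) :=
    hcl.continuousAt_comp (f := fun x => V (F (F x))) (by fun_prop)
  have hlim2 := (tendsto_add_atTop_iff_nat 2).2 hlim
  simp only [Function.iterate_succ_apply'] at hlim2
  refine heq q hq ?_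
  exact (h2.eq_of_tendsto hlim2).trans (h1.eq_of_tendsto hlim).symm

/-- Lyapunov's criterion on a compact forward invariant set. -/
theorem isLyapunovStable_of_lyapunov {X : Type*} [TopologicalSpace X] {F : X → X} {K : Set X}
    {V : X → ℝ} {c : X} (hK : IsCompact K) (hV : Continuous V)
    (hFK : MapsTo F K K) (hle : ∀ p ∈ K, V (F p) ≤ V p)
    (hc : ∀ p ∈ K, p ≠ c → V c < V p) : IsLyapunovStable F K c := by
  intro U hU
  obtain ⟨O, hOU, hO, hcO⟩ := mem_nhds_iff.1 hU
  obtain ⟨η, hη, hsub⟩ : ∃ η, V c < η ∧ ∀ p ∈ K, V p < η → p ∈ O := by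
    rcases (K \ O).eq_empty_or_nonempty with he | hne
    · refine ⟨V c + 1, by linarith, fun p hp _ => ?_⟩
      by_contra hpO
      exact (he ▸ (⟨hp, hpO⟩ : p ∈ K \ O) : p ∈ (∅ : Set X))
    · obtain ⟨m, hm, hmin⟩ := (hK.diff hO).exists_isMinOn hne hV.continuousOn
      refine ⟨V m, hc m hm.1 fun h => hm.2 (h ▸ hcO), fun p hp hpm => ?_⟩
      by_contra hpO
      exact absurd (hmin ⟨hp, hpO⟩) (not_le.2 hpm)
  refine ⟨{p | V p < η}, (isOpen_lt hV continuous_const).mem_nhds hη, ?_⟩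
  rintro p ⟨hpη, hpK⟩ n
  refine hOU (hsub _ (hFK.iterate n hpK) ?_)
  refine lt_of_le_of_lt ?_ hpη
  induction n with
  | zero => exact le_rfl
  | succ n ih =>
    rw [Function.iterate_succ_apply']
    exact (hle _ (hFK.iterate n hpK)).trans ih

/-- The cross coefficient for which the decrease of `tentEnergy` under the right branch of the
tent map is a multiple of the square of the present state's deviation. -/
noncomputable def crossCoeff (α : ℝ) : ℝ := 8 * α * (1 - α) / (3 - 2 * α)

/-- A quadratic Lyapunov function for the tent map with memory, centred at `(2/3, 2/3)`. -/
noncomputable def tentEnergy (α : ℝ) (p : ℝ × ℝ) : ℝ :=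
  (p.2 - 2 / 3) ^ 2 + crossCoeff α * (p.2 - 2 / 3) * (p.1 - 2 / 3)
    + 4 * (1 - α) ^ 2 * (p.1 - 2 / 3) ^ 2

theorem continuous_tentEnergy (α : ℝ) : Continuous (tentEnergy α) := by
  unfold tentEnergy
  fun_prop

theorem crossCoeff_mul {α : ℝ} (hα' : α < 3 / 4) : crossCoeff α * (3 - 2 * α) = 8 * α * (1 - α) :=
  div_mul_cancel₀ _ (by linarith)

theorem crossCoeff_lt_two {α : ℝ} (hα' : α < 3 / 4) : crossCoeff α < 2 := by
  rw [crossCoeff, div_lt_iff₀ (by linarith)]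
  nlinarith [sq_nonneg (2 * α - 1)]

theorem crossCoeff_lt {α : ℝ} (hα' : α < 3 / 4) : crossCoeff α < 4 * (1 - α) := by
  rw [crossCoeff, div_lt_iff₀ (by linarith)]
  nlinarith

/-- Amounts to `(2α - 1)(4α - 3) < 0`: this is where exactly the range of `α` enters. -/
theorem one_lt_crossCoeff {α : ℝ} (hα : 1 / 2 < α) (hα' : α < 3 / 4) : 1 < crossCoeff α := by
  rw [crossCoeff, lt_div_iff₀ (by linarith)]
  nlinarith

theorem tentEnergy_pos {α : ℝ} (hα : 1 / 2 < α) (hα' : α < 3 / 4)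
    {p : ℝ × ℝ} (hp : p ≠ (2 / 3, 2 / 3)) : 0 < tentEnergy α p := by
  obtain ⟨x, y⟩ := p
  have h1 := crossCoeff_lt hα'
  have h2 := one_lt_crossCoeff hα hα'
  -- Completing the square; `crossCoeff_lt` makes the remaining coefficient positive.
  have h3 : tentEnergy α (x, y) = ((y - 2 / 3) + crossCoeff α / 2 * (x - 2 / 3)) ^ 2
      + (4 * (1 - α) - crossCoeff α) * (4 * (1 - α) + crossCoeff α) / 4 * (x - 2 / 3) ^ 2 := by
    unfold tentEnergy
    ring
  have h4 : 0 < (4 * (1 - α) - crossCoeff α) * (4 * (1 - α) + crossCoeff α) / 4 := by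
    have := mul_pos (sub_pos.2 h1) (show 0 < 4 * (1 - α) + crossCoeff α by linarith)
    linarith
  rw [h3]
  by_cases hx : x = 2 / 3
  · have hy : y - 2 / 3 ≠ 0 := fun h => hp (by rw [hx, sub_eq_zero.1 h])
    subst hx
    have := pow_pos (abs_pos.2 hy) 2
    rw [sq_abs] at this
    simpa using this
  · have hx' : 0 < (x - 2 / 3) ^ 2 := sq_pos_of_ne_zero (sub_ne_zero.2 hx)
    have := mul_pos h4 hx'
    positivity

theorem tentEnergy_lt_zero_zero {α : ℝ} (hα : 1 / 2 < α) (hα' : α < 3 / 4)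
    {p : ℝ × ℝ} (hp : p ∈ unitSquare) (h0 : p ≠ (0, 0)) :
    tentEnergy α p < tentEnergy α (0, 0) := by
  obtain ⟨x, y⟩ := p
  obtain ⟨⟨hx0, hx1⟩, ⟨hy0, hy1⟩⟩ := hp
  simp only at hx0 hx1 hy0 hy1
  have h2 := one_lt_crossCoeff hα hα'
  have key : tentEnergy α (0, 0) - tentEnergy α (x, y) =
      y * (4 / 3 - y) + crossCoeff α * (x * (2 / 3 - y / 2) + y * (2 / 3 - x / 2))
        + 4 * (1 - α) ^ 2 * (x * (4 / 3 - x)) := by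
    unfold tentEnergy
    ring
  have hx : 0 ≤ x * (4 / 3 - x) := mul_nonneg hx0 (by linarith)
  have hy : 0 ≤ y * (4 / 3 - y) := mul_nonneg hy0 (by linarith)
  have hxy : 0 < x * (2 / 3 - y / 2) + y * (2 / 3 - x / 2) := by
    rcases hx0.eq_or_lt with rfl | hx0
    · have hy0 : 0 < y := hy0.lt_of_ne fun h => h0 (by rw [← h])
      linarith
    · exact add_pos_of_pos_of_nonneg (mul_pos hx0 (by linarith)) (mul_nonneg hy0 (by linarith))
  have h3 := mul_pos (zero_lt_one.trans h2) hxy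
  have h4 := mul_nonneg (show 0 ≤ 4 * (1 - α) ^ 2 by positivity) hx
  linarith

theorem tentEnergy_sub_of_half_le {α : ℝ} (hα' : α < 3 / 4) {x y : ℝ}
    (hz : 1 / 2 ≤ α * y + (1 - α) * x) :
    tentEnergy α (x, y) - tentEnergy α (memoryMap tent α (x, y)) =
      3 * (crossCoeff α - 1) * (y - 2 / 3) ^ 2 := by
  simp only [tentEnergy, memoryMap, tent, if_neg (not_lt.2 hz)]
  linear_combination ((y - 2 / 3) * (x - 2 / 3) - (y - 2 / 3) ^ 2) * crossCoeff_mul hα'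

/-- The last product corrects the right-branch formula for replacing `2 - 2z` by `2z`. -/
theorem tentEnergy_sub_of_lt_half {α : ℝ} (hα' : α < 3 / 4) {x y : ℝ}
    (hz : α * y + (1 - α) * x < 1 / 2) :
    tentEnergy α (x, y) - tentEnergy α (memoryMap tent α (x, y)) =
      3 * (crossCoeff α - 1) * (y - 2 / 3) ^ 2 + (2 - 4 * (α * y + (1 - α) * x))
        * (crossCoeff α * y - 2 / 3 * (crossCoeff α - 1)) := by
  simp only [tentEnergy, memoryMap, tent, if_pos hz]
  linear_combination ((y - 2 / 3) * (x - 2 / 3) - (y - 2 / 3) ^ 2) * crossCoeff_mul hα'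

theorem tentEnergy_memoryMap_le {α : ℝ} (hα : 1 / 2 < α) (hα' : α < 3 / 4) {p : ℝ × ℝ}
    (hp : p ∈ unitSquare) (h0 : p ≠ (0, 0)) :
    tentEnergy α (memoryMap tent α p) ≤ tentEnergy α p ∧
      (tentEnergy α (memoryMap tent α p) = tentEnergy α p → p.2 = 2 / 3) := by
  obtain ⟨x, y⟩ := p
  obtain ⟨⟨hx0, hx1⟩, ⟨hy0, hy1⟩⟩ := hp
  simp only at hx0 hx1 hy0 hy1
  have hc1 := one_lt_crossCoeff hα hα'
  have hc2 := crossCoeff_lt_two hα'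
  rcases le_or_gt (1 / 2) (α * y + (1 - α) * x) with hz | hz
  · have h := tentEnergy_sub_of_half_le hα' hz
    have hc : 0 < 3 * (crossCoeff α - 1) := by linarith
    refine ⟨by nlinarith [mul_nonneg hc.le (sq_nonneg (y - 2 / 3))], fun he => ?_⟩
    rw [he, sub_self, zero_eq_mul] at h
    exact sub_eq_zero.1 (sq_eq_zero_iff.1 (h.resolve_left hc.ne'))
  · have h := tentEnergy_sub_of_lt_half hα' hz
    set c := crossCoeff α
    set z := α * y + (1 - α) * x with hzdef
    have hz0 : 0 < z := by
      rcases hx0.eq_or_lt with rfl | hx0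
      · have hy0 : 0 < y := hy0.lt_of_ne fun h => h0 (by rw [← h])
        rw [hzdef]
        nlinarith
      · exact add_pos_of_nonneg_of_pos (mul_nonneg (by linarith) hy0) (mul_pos (by linarith) hx0)
    have hpos : 0 < 3 * (c - 1) * (y - 2 / 3) ^ 2
        + (2 - 4 * z) * (c * y - 2 / 3 * (c - 1)) := by
      -- The expression is affine in `z`. If the last factor is negative it increases with `z`, and
      -- its value at `z = 0` is `y * (4 - 2c + 3(c - 1)y)`, nonnegative since `1 < c < 2`.
      rcases lt_or_ge (c * y - 2 / 3 * (c - 1)) 0 with hR | hR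
      · have h1 := mul_pos_of_neg_of_neg (neg_lt_zero.2 hz0) hR
        have h2 : 0 ≤ y * (4 - 2 * c + 3 * (c - 1) * y) :=
          mul_nonneg hy0 (add_nonneg (by linarith) (mul_nonneg (by linarith) hy0))
        linarith
      · have h1 := mul_nonneg (show 0 ≤ 2 - 4 * z by linarith) hR
        rcases eq_or_ne y (2 / 3) with rfl | hy
        · linarith
        · have h2 : 0 < (y - 2 / 3) ^ 2 := sq_pos_of_ne_zero (sub_ne_zero.2 hy)
          have h3 := mul_pos (show 0 < 3 * (c - 1) by linarith) h2
          linarith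
    rw [← h] at hpos
    exact ⟨by linarith, fun he => by linarith⟩

theorem memoryMap_tent_zero (α : ℝ) : memoryMap tent α (0, 0) = (0, 0) := by
  norm_num [memoryMap, tent]

theorem memoryMap_tent_two_thirds (α : ℝ) :
    memoryMap tent α (2 / 3, 2 / 3) = (2 / 3, 2 / 3) := by
  have : α * (2 / 3) + (1 - α) * (2 / 3) = (2 / 3 : ℝ) := by ring
  norm_num [memoryMap, tent, this]

theorem eq_of_tentEnergy_iterate_two_eq {α : ℝ} (hα : 1 / 2 < α) (hα' : α < 3 / 4) {p : ℝ × ℝ}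
    (hp : p ∈ unitSquare) (h0 : p ≠ (0, 0))
    (h : tentEnergy α (memoryMap tent α (memoryMap tent α p)) = tentEnergy α p) :
    p = (2 / 3, 2 / 3) := by
  have h1 := tentEnergy_memoryMap_le hα hα' hp h0
  have hne : memoryMap tent α p ≠ (0, 0) := by
    intro he
    rw [he, memoryMap_tent_zero] at h
    exact (tentEnergy_lt_zero_zero hα hα' hp h0).ne' h
  have h2 := tentEnergy_memoryMap_le hα hα'
    (mapsTo_memoryMap_tent (by linarith) (by linarith) hp) hne
  have e1 : p.2 = 2 / 3 := h1.2 (le_antisymm h1.1 (h ▸ h2.1))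
  have e2 : (memoryMap tent α p).2 = 2 / 3 := h2.2 (le_antisymm h2.1 (h ▸ h1.1))
  obtain ⟨x, y⟩ := p
  obtain ⟨⟨hx0, hx1⟩, -⟩ := hp
  simp only at hx0 hx1 e1
  subst e1
  have h3 := mul_nonneg (show 0 ≤ 1 - α by linarith) hx0
  simp only [memoryMap, tent] at e2
  split_ifs at e2 with hz
  -- The left branch would need `z = 1/3`, but `z ≥ 2α/3 > 1/3`.
  · linarith
  · have h4 : (1 - α) * (x - 2 / 3) = 0 := by linarith
    rcases mul_eq_zero.1 h4 with h5 | h5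
    · linarith
    · rw [sub_eq_zero.1 h5]

theorem tendsto_iterate_memoryMap_tent {α : ℝ} (hα : 1 / 2 < α) (hα' : α < 3 / 4) {p : ℝ × ℝ}
    (hp : p ∈ unitSquare) (h0 : p ≠ (0, 0)) :
    Tendsto (fun n : ℕ => (memoryMap tent α)^[n] p) atTop (𝓝 (2 / 3, 2 / 3)) := by
  have hV := continuous_tentEnergy α
  have hne : ∀ q ∈ unitSquare ∩ {q | tentEnergy α q ≤ tentEnergy α p}, q ≠ (0, 0) := by
    rintro q ⟨-, hq⟩ rfl
    exact absurd (tentEnergy_lt_zero_zero hα hα' hp h0) (not_lt.2 hq)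
  -- The whole square would not do: the origin is fixed, so its energy is constant.
  refine tendsto_iterate_of_lyapunov
    (K := unitSquare ∩ {q | tentEnergy α q ≤ tentEnergy α p})
    (isCompact_unitSquare.inter_right (isClosed_le hV continuous_const))
    (continuous_memoryMap_tent α) hV ?_ ?_ ?_ ⟨hp, le_refl (tentEnergy α p)⟩
  · intro q hq
    exact ⟨mapsTo_memoryMap_tent (by linarith) (by linarith) hq.1,
      (tentEnergy_memoryMap_le hα hα' hq.1 (hne q hq)).1.trans hq.2⟩
  · exact fun q hq => (tentEnergy_memoryMap_le hα hα' hq.1 (hne q hq)).1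
  · exact fun q hq => eq_of_tentEnergy_iterate_two_eq hα hα' hq.1 (hne q hq)

theorem basin_memoryMap_tent {α : ℝ} (hα : 1 / 2 < α) (hα' : α < 3 / 4) :
    basin (memoryMap tent α) unitSquare (2 / 3, 2 / 3) =
      unitSquare \ {((0 : ℝ), (0 : ℝ))} := by
  ext p
  refine ⟨fun ⟨hp, ht⟩ => ⟨hp, ?_⟩,
    fun ⟨hp, h0⟩ => ⟨hp, tendsto_iterate_memoryMap_tent hα hα' hp h0⟩⟩
  rintro rfl
  simp only [Function.iterate_fixed (memoryMap_tent_zero α)] at ht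
  have := congrArg Prod.fst (tendsto_nhds_unique ht tendsto_const_nhds)
  norm_num at this

theorem theorem6 (α : ℝ) (hα : 1 / 2 < α) (hα' : α < 3 / 4) :
    MapsTo (memoryMap tent α) unitSquare unitSquare ∧
    basin (memoryMap tent α) unitSquare (2 / 3, 2 / 3) = unitSquare \ {((0 : ℝ), (0 : ℝ))} ∧
    IsAlmostGlobalAttractor (memoryMap tent α) unitSquare (2 / 3, 2 / 3) := by
  have hmaps : MapsTo (memoryMap tent α) unitSquare unitSquare :=
    mapsTo_memoryMap_tent (by linarith) (by linarith)
  have hbasin := basin_memoryMap_tent hα hα'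
  refine ⟨hmaps, hbasin, ⟨⟨?_, memoryMap_tent_two_thirds α, ?_, ?_⟩, ?_⟩⟩
  · constructor <;> constructor <;> norm_num
  · refine isLyapunovStable_of_lyapunov isCompact_unitSquare (continuous_tentEnergy α) hmaps ?_ ?_
    · intro p hp
      rcases eq_or_ne p (0, 0) with rfl | h0
      · rw [memoryMap_tent_zero]
      · exact (tentEnergy_memoryMap_le hα hα' hp h0).1
    · intro p _ hne
      have : tentEnergy α (2 / 3, 2 / 3) = 0 := by simp [tentEnergy]
      rw [this]
      exact tentEnergy_pos hα hα' hne
  · refine ⟨{(0, 0)}ᶜ, isOpen_compl_singleton.mem_nhds ?_, ?_⟩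
    · simp
    · rw [hbasin]
      exact fun p hp => ⟨hp.2, hp.1⟩
  · rw [hbasin, sdiff_sdiff_right_self]
    exact measure_mono_null inf_le_right (measure_singleton _)
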